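/- Define the Kleene-Kreisel spaces recursively: $\mathbb{N}_0 := \mathbb{N}$ with the discrete topology, and $\mathbb{N}_{k+1} := \mathbb{N}^{\mathbb{N}_k}$, the exponential formed in the category of sequential spaces, i.e. the set of all continuous functions $\mathbb{N}_k \to \mathbb{N}$ endowed with the sequentialisation of the compact-open topology (a set is open in it if and only if it is sequentially open with respect to the compact-open topology). A topological space $X$ satisfies *Normann's condition* if every functionally closed subset of $X$, i.e. every set of the form $f^{-1}[\{0\}]$ with $f \colon X \to [0,1]$ continuous, is an intersection of clopen subsets of $X$. Then for every $k \geq 2$, the space $\mathbb{N}_k$ does not satisfy Normann's condition. -/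

import Mathlib

open Filter Topology

section

variable {X : Type*}

/-- The sequentialisation (sequential coreflection) of a topology `t`: its open sets are the
sequentially open sets of `t`, that is, the sets that eventually contain every sequence which
converges with respect to `t` to one of their points. -/
abbrev seqTopology (t : TopologicalSpace X) : TopologicalSpace X where
  IsOpen U := ∀ (u : ℕ → X) (x : X), x ∈ U → Tendsto u atTop (@nhds X t x) → ∀ᶠ n in atTop, u n ∈ U
  isOpen_univ := fun _ _ _ _ => Eventually.of_forall fun _ => trivial
  isOpen_inter := fun _ _ hU hV u x hx hu => (hU u x hx.1 hu).and (hV u x hx.2 hu)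
  isOpen_sUnion := fun _ hS u x ⟨U, hU, hx⟩ hu =>
    (hS U hU u x hx hu).mono fun _ hn => ⟨U, hU, hn⟩

/-- A set is functionally closed if it is the preimage of `0` under a continuous function into the
unit interval. -/
def IsFunctionallyClosed [TopologicalSpace X] (A : Set X) : Prop :=
  ∃ f : C(X, unitInterval), A = f ⁻¹' {0}

end

/-- Normann's condition: every functionally closed subset is an intersection of clopen sets. -/
def NormannCondition (X : Type*) [TopologicalSpace X] : Prop :=
  ∀ A : Set X, IsFunctionallyClosed A →
    ∃ S : Set (Set X), (∀ C ∈ S, IsClopen C) ∧ A = ⋂₀ S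

/-- The underlying set of the exponential `Y ^ X`: all continuous functions from `X` to `Y`. -/
def SeqExp (X Y : Type*) [TopologicalSpace X] [TopologicalSpace Y] : Type _ := C(X, Y)

/-- The exponential `Y ^ X` carries the sequentialisation of the compact-open topology. For
sequential Hausdorff spaces this is the exponential in the category of sequential spaces; its
convergent sequences are the continuously convergent ones. -/
instance SeqExp.instTopologicalSpace (X Y : Type*) [TopologicalSpace X] [TopologicalSpace Y] :
    TopologicalSpace (SeqExp X Y) :=
  seqTopology (ContinuousMap.compactOpen : TopologicalSpace C(X, Y))

/-- The Kleene-Kreisel spaces: level `0` is the discrete space `ℕ`, and level `k + 1` is the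
exponential of `ℕ` by level `k`. -/
noncomputable def KleeneKreisel : ℕ → TopCat.{0}
  | 0 => TopCat.of ℕ
  | k + 1 => TopCat.of (SeqExp (KleeneKreisel k) ℕ)

/-!
Each level is a retract of the next one, and Normann's condition passes to retracts, so it is enough
to refute it for the functionals on Baire space (`not_normannCondition_typeTwo`).

The obstruction is that of Erdős space: in the space of sequences `q` in `ℓ¹` whose coordinate `q k`
is a multiple of `1 / (k + 1)` and nonnegative, with the topology of `ℓ¹`, no clopen neighbourhood
of `0` is disjoint from `{‖q‖ ≥ 1}`, although distinct points are separated by clopen sets.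
A functional `h` codes such a sequence by its values at points `(0, k, 0, …)`, while its values at
points `(i, β₁, β₂, …)` with `0 < i` are used as information on tails: `h β` is to bound all `n` for
which the coordinates in `[n, βₙ₊₁)` have weight more than `1 / i` (`Controls`). Two facts carry
the proof.

* The norm, cut off at `1`, extends to a function `weight` that is continuous on all functionals
  (`continuous_weight`). For an arbitrary `h` the coordinates are summed only as long as `h` is seen
  to control them, which is tested on finitely many arguments at each stage. If `h` controls all
  stages and `u m → h`, the tails of the sequences coded by `u m` are uniformly small: otherwise a
  sequence of humps yields a single argument `α` at which `h` is not finite.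
* Every sequence `q` as above is coded by a functional with full control, namely the one that takes
  the largest `n` with a hump of weight more than `1 / i` in `[n, βₙ₊₁)` (`canonical`), and this
  functional depends continuously on `q` (`tendsto_canonical`, for the limits that are needed).

Erdős' argument (`exists_weight_eq_one_of_isClopen`) then shows that every clopen set containing
the zero set of `1 - weight` contains the functional that codes the zero sequence, at which
`1 - weight` is `1`.
-/

/-! ### Exponentials and continuous convergence -/

namespace SeqExp

variable {X Y Z : Type*} [TopologicalSpace X] [TopologicalSpace Y] [TopologicalSpace Z]

instance instFunLike : FunLike (SeqExp X Y) X Y := inferInstanceAs (FunLike C(X, Y) X Y)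

instance instContinuousMapClass : ContinuousMapClass (SeqExp X Y) X Y :=
  inferInstanceAs (ContinuousMapClass C(X, Y) X Y)

theorem tendsto_iff_compactOpen {u : ℕ → SeqExp X Y} {g : SeqExp X Y} :
    Tendsto u atTop (𝓝 g) ↔ Tendsto (β := C(X, Y)) u atTop (@nhds C(X, Y) _ g) := by
  constructor
  · intro h
    refine (tendsto_nhds (X := C(X, Y))).2 fun U hU hg => ?_
    have hU' : IsOpen (X := SeqExp X Y) U := fun v y hy hv => hv (hU.mem_nhds hy)
    exact h (hU'.mem_nhds hg)
  · intro h
    exact tendsto_nhds.2 fun U hU hg => hU u g hg h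

theorem continuous_of_tendsto {f : SeqExp X Y → Z}
    (hf : ∀ (u : ℕ → SeqExp X Y) (g : SeqExp X Y), Tendsto u atTop (𝓝 g) →
      Tendsto (fun n => f (u n)) atTop (𝓝 (f g))) : Continuous f :=
  ⟨fun _ hU u g hg hu => hf u g (tendsto_iff_compactOpen.2 hu) (hU.mem_nhds hg)⟩

theorem continuous_eval (x : X) : Continuous fun g : SeqExp X Y => g x := by
  refine continuous_of_tendsto fun u g h => ?_
  exact ((ContinuousEvalConst.continuous_eval_const (F := C(X, Y)) x).tendsto _).comp (tendsto_iff_compactOpen.1 h)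

/-- Sequences that are locally eventually equal to `g` converge to `g`; no local compactness of `X`
is needed. -/
theorem tendsto_of_locally_eventually_eq {u : ℕ → SeqExp X ℕ} {g : SeqExp X ℕ}
    (h : ∀ x, ∃ t ∈ 𝓝 x, ∀ᶠ n in atTop, ∀ y ∈ t, u n y = g y) : Tendsto u atTop (𝓝 g) := by
  refine tendsto_iff_compactOpen.2 (ContinuousMap.tendsto_of_tendstoLocallyUniformly ?_)
  intro V hV x
  obtain ⟨t, ht, h⟩ := h x
  refine ⟨t, ht, h.mono fun n hn y hy => ?_⟩
  have : (g y, u n y) ∈ V := by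
    rw [hn y hy]
    exact refl_mem_uniformity hV
  exact this

/-- Convergence in `SeqExp X ℕ` is continuous convergence along every convergent sequence of
arguments, even when the arguments are fed to a subsequence. -/
theorem eventually_apply_eq {u : ℕ → SeqExp X ℕ} {g : SeqExp X ℕ} (hu : Tendsto u atTop (𝓝 g))
    {x : ℕ → X} {y : X} (hx : Tendsto x atTop (𝓝 y)) {φ : ℕ → ℕ} (hφ : Tendsto φ atTop atTop) :
    ∀ᶠ n in atTop, u (φ n) (x n) = g y := by
  have hg : ∀ᶠ n in atTop, g (x n) = g y :=
    (((map_continuous g).tendsto y).comp hx) (mem_nhds_discrete.2 rfl : {g y} ∈ 𝓝 (g y))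
  obtain ⟨N, hN⟩ := eventually_atTop.1 hg
  have hc : IsCompact (insert y (Set.range fun n => x (n + N))) :=
    (hx.comp (tendsto_add_atTop_nat N)).isCompact_insert_range
  have hm : ∀ᶠ m in atTop, Set.MapsTo (u m) (insert y (Set.range fun n => x (n + N))) {g y} := by
    refine ContinuousMap.tendsto_nhds_compactOpen.1 (tendsto_iff_compactOpen.1 hu) _ hc _
      (isOpen_discrete _) ?_
    rintro _ (rfl | ⟨n, rfl⟩)
    · rfl
    · exact hN _ (Nat.le_add_left _ _)
  filter_upwards [hφ.eventually hm, eventually_ge_atTop N] with n hn hNn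
  exact hn (Or.inr ⟨n - N, by simp [Nat.sub_add_cancel hNn]⟩)

/-- Precomposition with a continuous map. -/
def precomp (φ : C(X, Y)) : C(SeqExp Y Z, SeqExp X Z) where
  toFun g := ContinuousMap.comp g φ
  continuous_toFun := continuous_of_tendsto fun _ _ h => tendsto_iff_compactOpen.2
    (((ContinuousMap.continuous_precomp φ).tendsto _).comp (tendsto_iff_compactOpen.1 h))

end SeqExp

/-! ### Retracts -/

theorem NormannCondition.of_retract {X Y : Type*} [TopologicalSpace X] [TopologicalSpace Y]
    (hY : NormannCondition Y) (s : C(X, Y)) (r : C(Y, X)) (h : ∀ x, r (s x) = x) :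
    NormannCondition X := by
  rintro _ ⟨f, rfl⟩
  obtain ⟨S, hS, hA⟩ := hY ((f.comp r) ⁻¹' {0}) ⟨f.comp r, rfl⟩
  refine ⟨(fun C => s ⁻¹' C) '' S, ?_, ?_⟩
  · rintro _ ⟨C, hC, rfl⟩
    exact (hS C hC).preimage s.continuous
  · ext x
    have := Set.ext_iff.1 hA (s x)
    simpa [h] using this

theorem KleeneKreisel.exists_retract (k : ℕ) :
    ∃ (s : C(KleeneKreisel k, KleeneKreisel (k + 1)))
      (r : C(KleeneKreisel (k + 1), KleeneKreisel k)), ∀ x, r (s x) = x := by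
  induction k with
  | zero =>
    let s : C(ℕ, SeqExp ℕ ℕ) := ⟨fun n => ContinuousMap.const ℕ n, continuous_of_discreteTopology⟩
    let r : C(SeqExp ℕ ℕ, ℕ) := ⟨fun g => g 0, SeqExp.continuous_eval 0⟩
    exact ⟨s, r, fun x => rfl⟩
  | succ k ih =>
    obtain ⟨s, r, h⟩ := ih
    let s' : C(SeqExp (KleeneKreisel k) ℕ, SeqExp (KleeneKreisel (k + 1)) ℕ) := SeqExp.precomp r
    let r' : C(SeqExp (KleeneKreisel (k + 1)) ℕ, SeqExp (KleeneKreisel k) ℕ) := SeqExp.precomp s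
    refine ⟨s', r', fun g => ?_⟩
    refine DFunLike.ext (F := SeqExp (KleeneKreisel k) ℕ) _ _ fun x => ?_
    exact congrArg (DFunLike.coe (F := SeqExp (KleeneKreisel k) ℕ) g) (h x)

/-! ### Coded sequences and control of their tails -/

/-- The weight of the coordinates in `[m, n)` of a sequence `a` that codes the point of `ℓ¹` whose
`k`-th coordinate is `a k / (k + 1)`. -/
noncomputable def mass (a : ℕ → ℕ) (m n : ℕ) : ℝ := ∑ k ∈ Finset.Ico m n, (a k : ℝ) / (k + 1)

theorem mass_nonneg (a : ℕ → ℕ) (m n : ℕ) : 0 ≤ mass a m n :=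
  Finset.sum_nonneg fun _ _ => by positivity

theorem mass_anti_left (a : ℕ → ℕ) {m m' : ℕ} (h : m ≤ m') (n : ℕ) : mass a m' n ≤ mass a m n :=
  Finset.sum_le_sum_of_subset_of_nonneg (Finset.Ico_subset_Ico_left h) fun _ _ _ => by positivity

theorem mass_mono_right (a : ℕ → ℕ) (m : ℕ) {n n' : ℕ} (h : n ≤ n') : mass a m n ≤ mass a m n' :=
  Finset.sum_le_sum_of_subset_of_nonneg (Finset.Ico_subset_Ico_right h) fun _ _ _ => by positivity

theorem mass_congr {a a' : ℕ → ℕ} {m n : ℕ} (h : ∀ k < n, a k = a' k) : mass a m n = mass a' m n :=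
  Finset.sum_congr rfl fun k hk => by rw [h k (Finset.mem_Ico.1 hk).2]

theorem mass_of_le {a : ℕ → ℕ} {m n : ℕ} (h : n ≤ m) : mass a m n = 0 := by
  simp [mass, Finset.Ico_eq_empty_of_le h]

theorem mass_le_add (a : ℕ → ℕ) (m n : ℕ) : mass a 0 n ≤ mass a 0 m + mass a m n := by
  rcases le_total m n with h | h
  · exact (Finset.sum_Ico_consecutive _ (Nat.zero_le m) h).ge
  · rw [mass_of_le h, add_zero]
    exact mass_mono_right a 0 h

/-- The type-two functionals, as functionals on `SeqExp ℕ ℕ`. -/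
abbrev TypeTwo : Type := SeqExp (SeqExp ℕ ℕ) ℕ

/-- A sequence of natural numbers as a point of the exponential. -/
def seqPoint (β : ℕ → ℕ) : SeqExp ℕ ℕ := (⟨β, continuous_of_discreteTopology⟩ : C(ℕ, ℕ))

theorem seqPoint_apply (β : ℕ → ℕ) (n : ℕ) : seqPoint β n = β n := rfl

theorem tendsto_seqPoint {β : ℕ → ℕ → ℕ} {α : ℕ → ℕ} (h : ∀ j, ∀ᶠ n in atTop, β n j = α j) :
    Tendsto (fun n => seqPoint (β n)) atTop (𝓝 (seqPoint α)) :=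
  SeqExp.tendsto_of_locally_eventually_eq fun j =>
    ⟨{j}, mem_nhds_discrete.2 rfl, (h j).mono fun n hn y hy => by
      rw [Set.mem_singleton_iff.1 hy]; exact hn⟩

/-- The sequence coded by a functional: its values at the points `(0, k, 0, 0, …)`. -/
def code (h : TypeTwo) (k : ℕ) : ℕ := h (seqPoint fun j => if j = 1 then k else 0)

/-- The finite sequences of length at most `b + 1` with entries at most `b`, padded by zeros. -/
def boundedSeqs (b : ℕ) : Set (ℕ → ℕ) := {β | (∀ j, β j ≤ b) ∧ ∀ j, b < j → β j = 0}

theorem finite_boundedSeqs (b : ℕ) : (boundedSeqs b).Finite := by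
  refine (Set.finite_range fun (s : Fin (b + 1) → Fin (b + 1)) (j : ℕ) =>
    if hj : j < b + 1 then (s ⟨j, hj⟩ : ℕ) else 0).subset ?_
  rintro β ⟨h1, h2⟩
  refine ⟨fun j => ⟨β j, Nat.lt_succ_of_le (h1 j)⟩, funext fun j => ?_⟩
  by_cases hj : j < b + 1
  · simp [hj]
  · simp [hj, h2 j (by omega)]

theorem boundedSeqs_mono {b b' : ℕ} (h : b ≤ b') : boundedSeqs b ⊆ boundedSeqs b' :=
  fun _ hβ => ⟨fun j => (hβ.1 j).trans h, fun j hj => hβ.2 j (h.trans_lt hj)⟩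

/-- Up to stage `b`, the functional `h` controls the tails of the sequence it codes: for
`β = (i, β₁, β₂, …)` with `0 < i`, the number `h β` bounds all `n` for which the coordinates in
`[n, βₙ₊₁)` have weight more than `1 / i`. -/
def Controls (h : TypeTwo) (b : ℕ) : Prop :=
  ∀ β ∈ boundedSeqs b, 0 < β 0 → ∀ n, 1 / (β 0 : ℝ) < mass (code h) n (β (n + 1)) →
    n ≤ h (seqPoint β)

theorem Controls.anti {h : TypeTwo} {b b' : ℕ} (hc : Controls h b') (hb : b ≤ b') : Controls h b :=
  fun β hβ => hc β (boundedSeqs_mono hb hβ)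

section Continuity

variable {u : ℕ → TypeTwo} {h : TypeTwo}

theorem eventually_code_eq (hu : Tendsto u atTop (𝓝 h)) (b : ℕ) :
    ∀ᶠ m in atTop, ∀ k < b, code (u m) k = code h k :=
  (Set.finite_lt_nat b).eventually_all.2 fun _ _ =>
    SeqExp.eventually_apply_eq hu tendsto_const_nhds tendsto_id

theorem eventually_controls_iff (hu : Tendsto u atTop (𝓝 h)) (b : ℕ) :
    ∀ᶠ m in atTop, (Controls (u m) b ↔ Controls h b) := by
  have h1 : ∀ᶠ m in atTop, ∀ β ∈ boundedSeqs b, u m (seqPoint β) = h (seqPoint β) :=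
    (finite_boundedSeqs b).eventually_all.2 fun _ _ =>
      SeqExp.eventually_apply_eq hu tendsto_const_nhds tendsto_id
  filter_upwards [h1, eventually_code_eq hu b] with m hm hk
  refine forall₂_congr fun β hβ => forall₂_congr fun _ n => ?_
  rw [hm β hβ, mass_congr fun k hk' => hk k (hk'.trans_le (hβ.1 _))]

/-- A gliding hump: if the weights far out did not become uniformly small, then the humps could be
lined up along one sequence `α`, and `h α` would have to exceed every natural number. -/
theorem exists_eventually_mass_le (hu : Tendsto u atTop (𝓝 h)) (hc : ∀ b, Controls h b) {i : ℕ}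
    (hi : 0 < i) :
    ∃ K, ∀ᶠ m in atTop, ∀ b, Controls (u m) b → mass (code (u m)) K b ≤ 1 / (i : ℝ) := by
  by_contra hcon
  push Not at hcon
  have step : ∀ K B M : ℕ, ∃ m b, M ≤ m ∧ Controls (u m) (max b B) ∧
      1 / (i : ℝ) < mass (code (u m)) K b := by
    intro K B M
    obtain ⟨m, ⟨b, hb, hlt⟩, hm, hM⟩ := ((hcon K).and_eventually
      ((eventually_controls_iff hu B).and (eventually_ge_atTop M))).exists
    refine ⟨m, b, hM, ?_, hlt⟩
    rcases le_total b B with h' | h'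
    · rw [max_eq_right h']; exact hm.2 (hc B)
    · rwa [max_eq_left h']
  choose φ c hφ hctl hlt using step
  -- `B K` bounds `i`, the length `K + 1` and the entries of the hump sequence before stage `K`.
  let B : ℕ → ℕ := fun K => Nat.rec (i + 1) (fun K B => max (c K B K) B + 1) K
  have hB : ∀ K, B (K + 1) = max (c K (B K) K) (B K) + 1 := fun K => rfl
  have hBmono : Monotone B := monotone_nat_of_le_succ fun K => by rw [hB]; omega
  have hBK : ∀ K, K + 1 ≤ B K := by
    intro K
    induction K with
    | zero => simp [B]
    | succ K ih => rw [hB]; omega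
  have hBi : ∀ K, i ≤ B K := fun K => by
    have h0 : B 0 = i + 1 := rfl
    have := hBmono (Nat.zero_le K)
    omega
  let α : ℕ → ℕ := fun j => Nat.casesOn j i fun K => c K (B K) K
  have hα : ∀ K, α (K + 1) = c K (B K) K := fun K => rfl
  let β : ℕ → ℕ → ℕ := fun K j => if j ≤ K + 1 then α j else 0
  have hβ : ∀ K, β K ∈ boundedSeqs (max (c K (B K) K) (B K)) := by
    refine fun K => ⟨fun j => ?_, fun j hj => if_neg ?_⟩
    · simp only [β]
      split_ifs with hj
      · rcases j with _ | j
        · exact (hBi K).trans (le_max_right _ _)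
        · rw [hα]
          rcases Nat.lt_or_ge j K with hjK | hjK
          · have h1 := hB j
            have h2 := hBmono (show j + 1 ≤ K from hjK)
            have := le_max_left (c j (B j) j) (B j)
            have := le_max_right (c K (B K) K) (B K)
            omega
          · obtain rfl : j = K := by omega
            exact le_max_left _ _
      · exact Nat.zero_le _
    · have := hBK K
      have := le_max_right (c K (B K) K) (B K)
      omega
  have hlim : Tendsto (fun K => seqPoint (β K)) atTop (𝓝 (seqPoint α)) :=
    tendsto_seqPoint fun j => (eventually_ge_atTop j).mono fun K hK => if_pos (by omega)
  have hφ' : Tendsto (fun K => φ K (B K) K) atTop atTop :=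
    tendsto_atTop_mono (fun K => hφ K (B K) K) tendsto_id
  obtain ⟨K, hK, hKα⟩ := ((SeqExp.eventually_apply_eq hu hlim hφ').and
    (eventually_gt_atTop (h (seqPoint α)))).exists
  have h0 : β K 0 = i := by simp [β, α]
  have hK1 : β K (K + 1) = c K (B K) K := by simp [β, α]
  have := hctl K (B K) K (β K) (hβ K) (by rwa [h0]) K (by rw [h0, hK1]; exact hlt K (B K) K)
  omega

end Continuity

/-! ### The extended norm -/

open Classical in
/-- The weight of the first `b` coordinates coded by `h`, cut off at `1`, and counted only if `h`
controls the tails up to stage `b`. -/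
noncomputable def partialWeight (h : TypeTwo) (b : ℕ) : ℝ :=
  if Controls h b then min 1 (mass (code h) 0 b) else 0

/-- The weight of the sequence coded by `h`, cut off at `1`, as far as `h` controls its tails. -/
noncomputable def weight (h : TypeTwo) : ℝ := ⨆ b, partialWeight h b

theorem partialWeight_nonneg (h : TypeTwo) (b : ℕ) : 0 ≤ partialWeight h b := by
  unfold partialWeight
  split_ifs
  · exact le_min zero_le_one (mass_nonneg _ _ _)
  · exact le_rfl

theorem partialWeight_le_one (h : TypeTwo) (b : ℕ) : partialWeight h b ≤ 1 := by
  unfold partialWeight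
  split_ifs
  · exact min_le_left _ _
  · exact zero_le_one

theorem partialWeight_le_weight (h : TypeTwo) (b : ℕ) : partialWeight h b ≤ weight h :=
  le_ciSup ⟨1, Set.forall_mem_range.2 (partialWeight_le_one h)⟩ b

theorem weight_le_one (h : TypeTwo) : weight h ≤ 1 := ciSup_le (partialWeight_le_one h)

theorem weight_nonneg (h : TypeTwo) : 0 ≤ weight h :=
  (partialWeight_nonneg h 0).trans (partialWeight_le_weight h 0)

theorem eventually_partialWeight_eq {u : ℕ → TypeTwo} {h : TypeTwo} (hu : Tendsto u atTop (𝓝 h))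
    (b : ℕ) : ∀ᶠ m in atTop, partialWeight (u m) b = partialWeight h b := by
  filter_upwards [eventually_controls_iff hu b, eventually_code_eq hu b] with m h1 h2
  unfold partialWeight
  rw [mass_congr h2]
  by_cases hc : Controls h b
  · rw [if_pos (h1.2 hc), if_pos hc]
  · rw [if_neg (mt h1.1 hc), if_neg hc]

theorem continuous_weight : Continuous weight := by
  refine SeqExp.continuous_of_tendsto fun u h hu => ?_
  by_cases hc : ∀ b, Controls h b
  -- Up to an error of less than `ε`, both weights agree with the partial weight at stage `K`.
  · refine Metric.tendsto_atTop'.2 fun ε hε => ?_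
    obtain ⟨i, hi⟩ := exists_nat_one_div_lt hε
    obtain ⟨K, hK⟩ := exists_eventually_mass_le hu hc i.succ_pos
    have upper : ∀ g : TypeTwo, Controls g K →
        (∀ b, Controls g b → mass (code g) K b ≤ 1 / ((i + 1 : ℕ) : ℝ)) →
        weight g ≤ partialWeight g K + 1 / ((i + 1 : ℕ) : ℝ) := by
      intro g hgK hg
      refine ciSup_le fun b => ?_
      have hpos : (0 : ℝ) ≤ 1 / ((i + 1 : ℕ) : ℝ) := by positivity
      by_cases hb : Controls g b
      · have h1 := hg b hb
        have h2 := mass_le_add (code g) K b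
        simp only [partialWeight, if_pos hb, if_pos hgK]
        rcases min_cases (1 : ℝ) (mass (code g) 0 K) with h3 | h3
        · have := min_le_left (1 : ℝ) (mass (code g) 0 b)
          linarith
        · have := min_le_right (1 : ℝ) (mass (code g) 0 b)
          linarith
      · have := partialWeight_nonneg g K
        rw [show partialWeight g b = 0 from if_neg hb]
        linarith
    have hKh : ∀ b, Controls h b → mass (code h) K b ≤ 1 / ((i + 1 : ℕ) : ℝ) := by
      intro b hb
      obtain ⟨m, h1, h2, h3⟩ := (hK.and ((eventually_controls_iff hu b).and
        (eventually_code_eq hu b))).exists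
      rw [← mass_congr h3]
      exact h1 b (h2.2 hb)
    have key : ∀ᶠ m in atTop, dist (weight (u m)) (weight h) < ε := by
      filter_upwards [hK, eventually_controls_iff hu K, eventually_partialWeight_eq hu K]
        with m h1 h2 h3
      have e1 := upper (u m) (h2.2 (hc K)) h1
      have e2 := upper h (hc K) hKh
      have e3 := partialWeight_le_weight (u m) K
      have e4 := partialWeight_le_weight h K
      push_cast at e1 e2
      rw [Real.dist_eq, abs_lt]
      constructor <;> linarith
    obtain ⟨N, hN⟩ := eventually_atTop.1 key
    exact ⟨N, fun n hn => hN n hn.le⟩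
  -- Near `h` only the stages below `B` count, and the weight is locally constant along `u`.
  · push Not at hc
    obtain ⟨B, hB⟩ := hc
    refine tendsto_const_nhds.congr' ?_
    filter_upwards [eventually_controls_iff hu B,
      (Set.finite_lt_nat B).eventually_all.2 fun b _ => eventually_partialWeight_eq hu b]
      with m h1 h2
    refine congrArg iSup (funext fun b => ?_)
    rcases lt_or_ge b B with hb | hb
    · exact (h2 b hb).symm
    · have e1 : ¬ Controls h b := fun hc => hB (hc.anti hb)
      have e2 : ¬ Controls (u m) b := fun hc => hB (h1.1 (hc.anti hb))
      simp only [partialWeight, if_neg e1, if_neg e2]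

/-! ### Canonical functionals -/

/-- The sequences of naturals whose coded point `a k / (k + 1)` lies in `ℓ¹`: an analogue of
Erdős space. -/
abbrev ErdosSeq : Type := {a : ℕ → ℕ // Summable fun k => (a k : ℝ) / (k + 1)}

/-- All `n` for which the coordinates of `a` in `[n, αₙ₊₁)` have weight more than `1 / α₀`. This is
used only for `0 < α₀`. -/
def humps (a α : ℕ → ℕ) : Set ℕ := {n | 1 / (α 0 : ℝ) < mass a n (α (n + 1))}

open Classical in
/-- The value at `α` of the canonical functional that codes `a` and controls its tails. -/
noncomputable def canonicalValue (a α : ℕ → ℕ) : ℕ := if α 0 = 0 then a (α 1) else sSup (humps a α)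

theorem Summable.exists_mass_le {a : ℕ → ℕ} (ha : Summable fun k => (a k : ℝ) / (k + 1)) {ε : ℝ}
    (hε : 0 < ε) : ∃ K, ∀ b, mass a K b ≤ ε := by
  obtain ⟨K, hK⟩ := (((tendsto_sum_nat_add fun k => (a k : ℝ) / (k + 1)).eventually
    (gt_mem_nhds hε))).exists
  refine ⟨K, fun b => le_trans ?_ hK.le⟩
  rw [mass, Finset.sum_Ico_eq_sum_range]
  have hs := (summable_nat_add_iff K).2 ha
  refine le_trans (le_of_eq ?_) (hs.sum_le_tsum (Finset.range (b - K)) fun k _ => by positivity)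
  exact Finset.sum_congr rfl fun k _ => by rw [Nat.add_comm K k]

/-- Beyond `K` there are no humps, so the canonical value depends on finitely many entries only. -/
theorem canonicalValue_congr {a a' α α' : ℕ → ℕ} {K M : ℕ}
    (hα : ∀ j < K + 2, α' j = α j) (hM : ∀ j < K + 2, α j < M) (ha : ∀ k < M, a' k = a k)
    (hK : 0 < α 0 → ∀ b, mass a K b ≤ 1 / (α 0 : ℝ))
    (hK' : 0 < α 0 → ∀ b, mass a' K b ≤ 1 / (α 0 : ℝ)) :
    canonicalValue a' α' = canonicalValue a α := by
  have h0 := hα 0 (by omega)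
  have h1 := hα 1 (by omega)
  unfold canonicalValue
  rw [h0, h1, ha _ (hM 1 (by omega))]
  split_ifs with hα0
  · rfl
  have hpos := Nat.pos_of_ne_zero hα0
  congr 1
  ext n
  simp only [humps, Set.mem_ofPred_eq, h0]
  rcases lt_or_ge n K with hn | hn
  · rw [hα (n + 1) (by omega), mass_congr fun k hk => ha k (hk.trans (hM (n + 1) (by omega)))]
  · exact iff_of_false ((mass_anti_left a' hn _).trans (hK' hpos _)).not_gt
      ((mass_anti_left a hn _).trans (hK hpos _)).not_gt

theorem eventually_agree (α : SeqExp ℕ ℕ) (K : ℕ) : ∀ᶠ β in 𝓝 α, ∀ j < K, β j = α j :=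
  (Set.finite_lt_nat K).eventually_all.2 fun j _ =>
    ((SeqExp.continuous_eval j).tendsto α) (mem_nhds_discrete.2 rfl : {α j} ∈ 𝓝 (α j))

theorem exists_bound (α : ℕ → ℕ) (K : ℕ) : ∃ M, ∀ j < K, α j < M :=
  ⟨(Finset.range K).sup α + 1, fun _ hj =>
    Nat.lt_succ_of_le (Finset.le_sup (f := α) (Finset.mem_range.2 hj))⟩

theorem ErdosSeq.exists_mass_le (x : ErdosSeq) (i : ℕ) :
    ∃ K, ∀ b, mass x.1 K b ≤ 1 / (2 * ((i : ℝ) + 1)) :=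
  x.2.exists_mass_le (by positivity)

theorem one_div_two_mul_le {i : ℕ} (hi : 0 < i) :
    1 / (2 * ((i : ℝ) + 1)) ≤ 1 / 2 * (1 / (i : ℝ)) := by
  have : (0 : ℝ) < i := Nat.cast_pos.2 hi
  rw [one_div_mul_one_div]
  exact one_div_le_one_div_of_le (by positivity) (by linarith)

/-- The canonical functional that codes a point of `ErdosSeq` and controls its tails. -/
noncomputable def canonical (x : ErdosSeq) : TypeTwo :=
  (⟨fun α => canonicalValue x.1 α, by
    refine IsLocallyConstant.continuous ((IsLocallyConstant.iff_eventually_eq _).2 fun α => ?_)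
    obtain ⟨K, hK⟩ := x.exists_mass_le (α 0)
    obtain ⟨M, hM⟩ := exists_bound α (K + 2)
    have hK' : 0 < α 0 → ∀ b, mass x.1 K b ≤ 1 / (α 0 : ℝ) := fun hi b => by
      have h1 := hK b
      have h2 := one_div_two_mul_le hi
      have : (0 : ℝ) ≤ 1 / (α 0 : ℝ) := by positivity
      linarith
    filter_upwards [eventually_agree α (K + 2)] with β hβ
    exact canonicalValue_congr hβ hM (fun _ _ => rfl) hK' hK'⟩ : C(SeqExp ℕ ℕ, ℕ))

theorem canonical_apply (x : ErdosSeq) (α : SeqExp ℕ ℕ) :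
    canonical x α = canonicalValue x.1 α := rfl

theorem code_canonical (x : ErdosSeq) : code (canonical x) = x.1 := by
  funext k
  simp [code, canonical_apply, canonicalValue, seqPoint_apply]

theorem controls_canonical (x : ErdosSeq) (b : ℕ) : Controls (canonical x) b := by
  intro β _ hβ0 n hn
  rw [code_canonical] at hn
  obtain ⟨K, hK⟩ := x.2.exists_mass_le (ε := 1 / (β 0 : ℝ)) (by positivity)
  have hbdd : BddAbove (humps x.1 β) := ⟨K, fun m hm => by
    by_contra hlt
    exact ((mass_anti_left x.1 (not_le.1 hlt).le _).trans (hK _)).not_gt hm⟩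
  have : canonical x (seqPoint β) = sSup (humps x.1 β) := if_neg hβ0.ne'
  rw [this]
  exact le_csSup hbdd hn

theorem partialWeight_canonical (x : ErdosSeq) (b : ℕ) :
    partialWeight (canonical x) b = min 1 (mass x.1 0 b) := by
  rw [← code_canonical x]
  exact if_pos (controls_canonical x b)

/-- The sequences `a m` converge to `x` in `ℓ¹`, being dominated by `x` except for one more unit, of
weight `1 / (m + 1)`, in coordinate `m`. Their canonical functionals converge, too. -/
theorem tendsto_canonical {a : ℕ → ErdosSeq} {x : ErdosSeq} (heq : ∀ m, ∀ k < m, (a m).1 k = x.1 k)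
    (hle : ∀ m k, (a m).1 k ≤ x.1 k + if k = m then 1 else 0) :
    Tendsto (fun m => canonical (a m)) atTop (𝓝 (canonical x)) := by
  have hmass : ∀ m K b, mass (a m).1 K b ≤ mass x.1 K b + 1 / ((m : ℝ) + 1) := by
    intro m K b
    have h1 : ∀ k ∈ Finset.Ico K b, ((a m).1 k : ℝ) / (k + 1) ≤
        (x.1 k : ℝ) / (k + 1) + if k = m then 1 / ((m : ℝ) + 1) else 0 := by
      intro k _
      have h2 : ((a m).1 k : ℝ) ≤ x.1 k + if k = m then 1 else 0 := by exact_mod_cast hle m k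
      refine (div_le_div_of_nonneg_right h2 (by positivity)).trans (le_of_eq ?_)
      split_ifs with hk
      · rw [hk, add_div]
      · simp
    refine (Finset.sum_le_sum h1).trans ?_
    rw [Finset.sum_add_distrib, Finset.sum_ite_eq']
    refine add_le_add le_rfl ?_
    split_ifs
    · exact le_rfl
    · positivity
  refine SeqExp.tendsto_of_locally_eventually_eq fun α => ?_
  obtain ⟨K, hK⟩ := x.exists_mass_le (α 0)
  obtain ⟨M, hM⟩ := exists_bound α (K + 2)
  refine ⟨_, eventually_agree α (K + 2), ?_⟩
  filter_upwards [eventually_ge_atTop M, eventually_ge_atTop (2 * α 0)] with m hm hm' β hβ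
  have hx : 0 < α 0 → ∀ b, mass x.1 K b ≤ 1 / (α 0 : ℝ) := fun hi b => by
    have h1 := hK b
    have h2 := one_div_two_mul_le hi
    have : (0 : ℝ) ≤ 1 / (α 0 : ℝ) := by positivity
    linarith
  have ha : 0 < α 0 → ∀ b, mass (a m).1 K b ≤ 1 / (α 0 : ℝ) := fun hi b => by
    have h1 := hK b
    have h2 := one_div_two_mul_le hi
    have h3 := hmass m K b
    have h4 : 1 / ((m : ℝ) + 1) ≤ 1 / 2 * (1 / (α 0 : ℝ)) := by
      have : (0 : ℝ) < (α 0 : ℝ) := Nat.cast_pos.2 hi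
      have : (2 * (α 0 : ℝ)) ≤ m := by exact_mod_cast hm'
      rw [one_div_mul_one_div]
      exact one_div_le_one_div_of_le (by positivity) (by linarith)
    linarith
  rw [canonical_apply, canonical_apply,
    canonicalValue_congr hβ hM (fun k hk => heq m k (hk.trans_le hm)) hx ha,
    canonicalValue_congr hβ hM (fun _ _ => rfl) hx hx]

/-! ### Erdős' argument -/

/-- If `Q` holds at `0` but at no finite sequence of weight at least `1`, then there is a sequence
all of whose initial segments satisfy `Q`, although increasing the next coordinate by one step too
many violates it. -/
theorem exists_boundary_sequence {Q : (ℕ → ℕ) → Prop} (h0 : Q fun _ => 0)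
    (hbig : ∀ a n, (∀ k, n ≤ k → a k = 0) → 1 ≤ mass a 0 n → ¬ Q a) :
    ∃ x : ℕ → ℕ, ∀ n, Q (fun k => if k < n then x k else 0) ∧
      ¬ Q (fun k => if k < n then x k else if k = n then x n + 1 else 0) := by
  classical
  have step : ∀ (n : ℕ) (a : ℕ → ℕ), ∃ j, (∀ k, n ≤ k → a k = 0) → Q a →
      Q (Function.update a n j) ∧ ¬ Q (Function.update a n (j + 1)) := by
    intro n a
    by_cases ha : (∀ k, n ≤ k → a k = 0) ∧ Q a
    · have hex : ∃ j, ¬ Q (Function.update a n j) := by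
        -- The value `n + 1` in coordinate `n` has weight `1` by itself.
        refine ⟨n + 1, hbig _ (n + 1) (fun k hk => ?_) ?_⟩
        · rw [Function.update_of_ne (by omega), ha.1 k (by omega)]
        · refine le_trans (le_of_eq ?_) (mass_anti_left _ (Nat.zero_le n) _)
          have : ((n : ℝ) + 1) ≠ 0 := by positivity
          simp [mass, this]
      have hne : Nat.find hex ≠ 0 := fun h => by
        have := Nat.find_spec hex
        rw [h, ← ha.1 n le_rfl, Function.update_eq_self] at this
        exact this ha.2
      obtain ⟨j, hj⟩ := Nat.exists_eq_succ_of_ne_zero hne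
      refine ⟨j, fun _ _ => ⟨not_not.1 (Nat.find_min hex (by omega)), ?_⟩⟩
      have := Nat.find_spec hex
      rwa [hj] at this
    · exact ⟨0, fun h1 h2 => (ha ⟨h1, h2⟩).elim⟩
  choose g hg using step
  let A : ℕ → ℕ → ℕ := fun n => Nat.rec (fun _ => 0) (fun n a => Function.update a n (g n a)) n
  have hA : ∀ n, A (n + 1) = Function.update (A n) n (g n (A n)) := fun _ => rfl
  let x : ℕ → ℕ := fun n => g n (A n)
  have hAx : ∀ n, A n = fun k => if k < n then x k else 0 := by
    intro n
    induction n with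
    | zero => simp [A]
    | succ n ih =>
      rw [hA]
      funext k
      rcases eq_or_ne k n with rfl | hk
      · simp [x]
      · rw [Function.update_of_ne hk, ih]
        exact if_congr (by omega) rfl rfl
  have hsupp : ∀ n k, n ≤ k → A n k = 0 := fun n k hk => by rw [hAx]; exact if_neg hk.not_gt
  have hQ : ∀ n, Q (A n) := by
    intro n
    induction n with
    | zero => exact h0
    | succ n ih => exact (hg n (A n) (hsupp n) ih).1
  refine ⟨x, fun n => ⟨hAx n ▸ hQ n, ?_⟩⟩
  convert (hg n (A n) (hsupp n) (hQ n)).2 using 2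
  funext k
  rcases eq_or_ne k n with rfl | hk
  · simp [x]
  · rw [Function.update_of_ne hk, hAx]
    simp [hk]

theorem summable_of_support {a : ℕ → ℕ} {n : ℕ} (h : ∀ k, n ≤ k → a k = 0) :
    Summable fun k => (a k : ℝ) / (k + 1) :=
  summable_of_ne_finset_zero (s := Finset.range n) fun k hk => by
    rw [h k (not_lt.1 fun hlt => hk (Finset.mem_range.2 hlt))]; simp

/-- The zero sequence. -/
def ErdosSeq.zero : ErdosSeq := ⟨fun _ => 0, summable_of_support (n := 0) fun _ _ => rfl⟩

/-- Erdős' argument. If `D` held no point of weight `1`, one could increase one coordinate at a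
time up to the boundary of `D`, in steps of size `1 / (k + 1)` in coordinate `k`. The weights being
bounded, the points obtained converge, and their limit lies in both `D` and its complement. -/
theorem exists_weight_eq_one_of_isClopen {D : Set TypeTwo} (hD : IsClopen D)
    (h0 : canonical ErdosSeq.zero ∈ D) : ∃ h ∈ D, weight h = 1 := by
  by_contra hcon
  push Not at hcon
  let Q : (ℕ → ℕ) → Prop := fun a => ∃ ha : Summable fun k => (a k : ℝ) / (k + 1),
    canonical ⟨a, ha⟩ ∈ D
  have hbig : ∀ a n, 1 ≤ mass a 0 n → ¬ Q a := by
    rintro a n hn ⟨ha, hQ⟩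
    refine hcon _ hQ (le_antisymm (weight_le_one _) ?_)
    refine le_trans (le_of_eq ?_) (partialWeight_le_weight _ n)
    rw [partialWeight_canonical]
    exact (min_eq_left hn).symm
  obtain ⟨x, hx⟩ := exists_boundary_sequence (Q := Q) ⟨ErdosSeq.zero.2, h0⟩
    fun a n _ => hbig a n
  have hxs : Summable fun k => (x k : ℝ) / (k + 1) := by
    refine summable_of_sum_range_le (c := 1) (fun k => by positivity) fun n => ?_
    by_contra hlt
    refine hbig _ n ?_ (hx n).1
    rw [mass_congr (a' := x) fun k hk => if_pos hk, mass, ← Finset.range_eq_Ico]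
    exact (not_le.1 hlt).le
  choose hin hinD using fun n => (hx n).1
  have hout : ∀ n, Summable fun k : ℕ =>
      (((if k < n then x k else if k = n then x n + 1 else 0 : ℕ)) : ℝ) / (k + 1) := fun n =>
    summable_of_support (a := fun k => if k < n then x k else if k = n then x n + 1 else 0)
      (n := n + 1) fun k hk => by
        rw [if_neg (by omega), if_neg (by omega)]
  have houtD : ∀ n, canonical ⟨_, hout n⟩ ∉ D := fun n h => (hx n).2 ⟨hout n, h⟩
  have lim1 := tendsto_canonical (a := fun n => ⟨_, hin n⟩) (x := ⟨x, hxs⟩)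
    (fun m k hk => if_pos hk) fun m k => by
      dsimp only
      split_ifs <;> omega
  have lim2 := tendsto_canonical (a := fun n => ⟨_, hout n⟩) (x := ⟨x, hxs⟩)
    (fun m k hk => if_pos hk) fun m k => by
      dsimp only
      split_ifs with h1 h2 h3
      · omega
      · omega
      · rw [h3]
      · omega
  have mem : canonical ⟨x, hxs⟩ ∈ D := hD.1.mem_of_tendsto lim1 (Eventually.of_forall hinD)
  exact hD.compl.1.mem_of_tendsto lim2 (Eventually.of_forall houtD) mem

theorem not_normannCondition_typeTwo : ¬ NormannCondition TypeTwo := by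
  intro hN
  let f : C(TypeTwo, unitInterval) :=
    ⟨fun h => ⟨1 - weight h, sub_nonneg.2 (weight_le_one h), sub_le_self _ (weight_nonneg h)⟩,
      (continuous_const.sub continuous_weight).subtype_mk _⟩
  have hf : ∀ h, h ∈ f ⁻¹' {0} ↔ weight h = 1 := fun h => by
    rw [Set.mem_preimage, Set.mem_singleton_iff, ← Subtype.coe_inj]
    exact sub_eq_zero.trans eq_comm
  obtain ⟨S, hS, hA⟩ := hN _ ⟨f, rfl⟩
  have hzero : weight (canonical ErdosSeq.zero) = 0 := by
    refine (congrArg iSup (funext fun b => ?_)).trans ciSup_const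
    rw [partialWeight_canonical]
    simp [ErdosSeq.zero, mass]
  have hp : canonical ErdosSeq.zero ∉ ⋂₀ S := by
    rw [← hA, hf, hzero]
    exact zero_ne_one
  obtain ⟨C, hC, hpC⟩ : ∃ C ∈ S, canonical ErdosSeq.zero ∉ C := by
    simpa [Set.mem_sInter] using hp
  obtain ⟨h, hhC, hw⟩ := exists_weight_eq_one_of_isClopen (hS C hC).compl hpC
  have : h ∈ ⋂₀ S := hA ▸ (hf h).2 hw
  exact hhC (this C hC)

theorem corollary4p3 (k : ℕ) (hk : 2 ≤ k) : ¬ NormannCondition (KleeneKreisel k) := by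
  induction k, hk using Nat.le_induction with
  | base => exact not_normannCondition_typeTwo
  | succ k _ ih =>
    obtain ⟨s, r, h⟩ := KleeneKreisel.exists_retract k
    exact fun hN => ih (hN.of_retract s r h)
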